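/- For $d\ge 1$ and $\kappa\ge 1$ let $\mathcal S_d(\kappa)$ be the set of real symmetric $d\times d$ matrices $\Sigma$ with $\frac1\kappa I\preceq\Sigma\preceq I$, and let $\mathcal C_d(\kappa)=\{\mathcal N(0,\Sigma):\Sigma\in\mathcal S_d(\kappa)\}$. The Gaussian covariance channel over $\mathcal C_d(\kappa)$ has input $\Sigma\in\mathcal S_d(\kappa)$ and output one sample $Y\sim\mathcal N(0,\Sigma)$ in $\mathbb R^d$. For an integer $k'\ge 0$, a one-shot $k'$-bit code consists of matrices $\Sigma_1,\dots,\Sigma_{2^{k'}}\in\mathcal S_d(\kappa)$ and a measurable decoder $D:\mathbb R^d\to\{1,\dots,2^{k'}\}$; its average error is $2^{-k'}\sum_{m=1}^{2^{k'}}\Pr_{Y\sim\mathcal N(0,\Sigma_m)}[D(Y)\ne m]$. Let $\epsilon_{\mathrm G}(k')$ be the infimum of the average error over all such codes. The one-sample capacity in bits is $C_{2,d}(\kappa)=\sup_{\Pi} I(\Theta;Y)$, where $\Pi$ ranges over all Borel probability measures on $\mathcal S_d(\kappa)$, $\Theta\sim\Pi$, $Y\mid\Theta\sim\mathcal N(0,\Theta)$,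 and the mutual information $I$ is measured in bits. **Theorem (One-shot coding bound for covariance-bounded Gaussians).** For every $\rho\in(0,1)$ there are constants $c_\rho>0$ and $\kappa_\rho<\infty$, depending only on $\rho$ (in particular independent of $d$), such that for all integers $d\ge 2$, all real $\kappa\ge\kappa_\rho$, and every integer $k'\ge0$ with $k'\le c_\rho\, d\log_2\kappa$, there is a one-shot $k'$-bit code with average error at most $\rho$; in particular $$\epsilon_{\mathrm G}(k')\le\rho .$$ Consequently, there exist universal constants $c>0$ and $\kappa_0<\infty$ such that for all integers $d\ge2$ and all real $\kappa\ge\kappa_0$, $$C_{2,d}(\kappa)\ \ge\ c\,d\log_2\kappa .$$ -/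

import Mathlib

open MeasureTheory ProbabilityTheory InformationTheory
open scoped ENNReal

noncomputable section

namespace GaussianCovarianceChannel

/-- The admissible covariance matrices: the real (symmetric, positive semidefinite) covariance
matrices `S` of size `d × d` with `(1/κ) I ≼ S ≼ I` in the Loewner order. (Positive
semidefiniteness follows from the lower bound when `κ > 0`.) -/
def covarianceSet (d : ℕ) (κ : ℝ) : Set (Matrix (Fin d) (Fin d) ℝ) :=
  {S | S.PosSemidef ∧ (S - (1 / κ) • (1 : Matrix (Fin d) (Fin d) ℝ)).PosSemidef ∧
    ((1 : Matrix (Fin d) (Fin d) ℝ) - S).PosSemidef}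

/-- The centred Gaussian law `N(0, S)` on `ℝ^d`. -/
def gaussianLaw {d : ℕ} (S : Matrix (Fin d) (Fin d) ℝ) : Measure (EuclideanSpace ℝ (Fin d)) :=
  multivariateGaussian 0 S

/-- The input alphabet of the Gaussian covariance channel. -/
abbrev Input (d : ℕ) (κ : ℝ) : Type := ↥(covarianceSet d κ)

/-- The input alphabet carries the Borel `σ`-algebra of the usual topology of matrices. -/
instance instMeasurableSpaceInput (d : ℕ) (κ : ℝ) : MeasurableSpace (Input d κ) := borel _

instance instBorelSpaceInput (d : ℕ) (κ : ℝ) : BorelSpace (Input d κ) := ⟨rfl⟩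

open scoped MatrixOrder Matrix.Norms.L2Operator in
theorem continuousOn_sqrt (d : ℕ) :
    ContinuousOn (CFC.sqrt : Matrix (Fin d) (Fin d) ℝ → Matrix (Fin d) (Fin d) ℝ)
      {S | S.PosSemidef} := by
  have := CFC.continuousOn_sqrt (A := Matrix (Fin d) (Fin d) ℝ)
  simpa [Matrix.nonneg_iff_posSemidef] using this

open scoped MatrixOrder in
theorem measurable_sqrt_apply (d : ℕ) (κ : ℝ) :
    Measurable (fun p : Input d κ × EuclideanSpace ℝ (Fin d) =>
      (0 : EuclideanSpace ℝ (Fin d)) +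
        Matrix.toEuclideanCLM (𝕜 := ℝ) (CFC.sqrt p.1.1) p.2) := by
  have : SecondCountableTopology (Matrix (Fin d) (Fin d) ℝ) :=
    inferInstanceAs (SecondCountableTopology (Fin d → Fin d → ℝ))
  have hs : Continuous (fun S : Input d κ => CFC.sqrt S.1) :=
    (continuousOn_sqrt d).comp_continuous continuous_subtype_val (fun S => S.2.1)
  have hc : Continuous (fun p : Input d κ × EuclideanSpace ℝ (Fin d) =>
      WithLp.toLp 2 ((CFC.sqrt p.1.1).mulVec (WithLp.ofLp p.2))) := by
    refine (PiLp.continuous_toLp 2 _).comp ?_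
    exact (hs.comp continuous_fst).matrix_mulVec
      ((PiLp.continuous_ofLp 2 _).comp continuous_snd)
  have := hc.measurable
  convert this using 2 with p
  rw [zero_add]
  rfl

/-- The Gaussian covariance channel: the input is an admissible covariance matrix `S`, the
output is one sample from `N(0, S)`. -/
def channel (d : ℕ) (κ : ℝ) : Kernel (Input d κ) (EuclideanSpace ℝ (Fin d)) where
  toFun S := gaussianLaw S.1
  measurable' := by
    refine Measure.measurable_of_measurable_coe _ fun s hs => ?_
    have h := measurable_measure_prodMk_left
      (ν := stdGaussian (EuclideanSpace ℝ (Fin d))) ((measurable_sqrt_apply d κ) hs)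
    convert h using 2 with S
    exact Measure.map_apply (by fun_prop) hs

instance instIsMarkovKernelChannel (d : ℕ) (κ : ℝ) : IsMarkovKernel (channel d κ) :=
  ⟨fun S => inferInstanceAs (IsProbabilityMeasure (multivariateGaussian 0 S.1))⟩

/-- A one-shot code for `k`-bit messages over the Gaussian covariance channel: `2^k` codewords,
which are admissible covariance matrices, and a measurable decoder. -/
structure Code (d : ℕ) (κ : ℝ) (k : ℕ) where
  encode : Fin (2 ^ k) → Input d κ
  decode : EuclideanSpace ℝ (Fin d) → Fin (2 ^ k)
  measurable_decode : Measurable decode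

/-- The average error probability of a code: the probability that the decoder applied to
`Y ∼ N(0, Σ_M)` does not return `M`, for a uniform message `M`. -/
def Code.averageError {d : ℕ} {κ : ℝ} {k : ℕ} (C : Code d κ k) : ℝ≥0∞ :=
  (∑ m : Fin (2 ^ k), channel d κ (C.encode m) {y | C.decode y ≠ m}) / (2 ^ k : ℝ≥0∞)

/-- The best one-shot average error probability for `k`-bit messages. -/
def oneShotError (d : ℕ) (κ : ℝ) (k : ℕ) : ℝ≥0∞ :=
  ⨅ C : Code d κ k, C.averageError

/-- The mutual information `I(Θ; Y)`, in nats, of an input `Θ ∼ P` and the output `Y` of the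
channel `W`: the Kullback–Leibler divergence of the joint law of `(Θ, Y)` from the product of its
marginals. -/
def mutualInformation {X Y : Type*} [MeasurableSpace X] [MeasurableSpace Y]
    (P : Measure X) (W : Kernel X Y) : ℝ≥0∞ :=
  klDiv (P.compProd W) (P.prod (P.bind W))

/-- The one-sample capacity in bits: the supremum of the mutual information, divided by `log 2`,
over all prior distributions on the admissible covariance matrices. -/
def capacityBits (d : ℕ) (κ : ℝ) : ℝ≥0∞ :=
  ⨆ P : ProbabilityMeasure (Input d κ),
    mutualInformation (P : Measure (Input d κ)) (channel d κ) / ENNReal.ofReal (Real.log 2)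

end GaussianCovarianceChannel

end

namespace GaussianCovarianceChannel

/-! ### A Gilbert–Varshamov bound -/

/-! Split the coordinates into `M = d / 2` disjoint pairs `(p, q)`. On each pair let the covariance
be `1/κ` times the identity plus a rank-one term along `e_p + a e_q`. Then `y_p` has variance at
least `1/4` while `y_q - a y_p` has variance of order `1/κ`, so one sample reveals the slope `a`, as
`y_q / y_p`, to precision about `κ ^ (-1/2)`. A polynomially large alphabet of slopes therefore
fits, and each pair carries order `log κ` bits.

Individual pairs may still fail, so the slope words come from a Gilbert–Varshamov code with distance
at least `M / 2`. By Markov's inequality fewer than `M / 4` pairs fail with high probability, and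
two words cannot both explain the same sample that well (`hammingDist_le_of_errorCount_lt`). This
gives `exists_code`.

For capacity, take the uniform prior on the codewords. Correct decoding has probability at least
`1/2` under the joint law but exactly `2 ^ (-k)` under the product law. A Fano-type bound from
convex duality (`mul_measure_le_klDiv_add`) then forces the divergence to be of order `k`. -/

theorem card_hammingBall_le {M h : ℕ} (h0 : 0 < h) (x : Fin M → Fin (4 * h ^ 2)) :
    (Finset.univ.filter fun y => 2 * hammingDist x y < M).card ≤ 2 ^ M * (2 * h) ^ M := by
  classical
  have hsub : (Finset.univ.filter fun y => 2 * hammingDist x y < M) ⊆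
      (Finset.univ.filter fun T : Finset (Fin M) => 2 * T.card < M).biUnion
        fun T => Fintype.piFinset fun i => if i ∈ T then Finset.univ else {x i} := by
    intro y hy
    simp only [Finset.mem_filter, Finset.mem_univ, true_and] at hy
    simp only [Finset.mem_biUnion, Finset.mem_filter, Finset.mem_univ, true_and,
      Fintype.mem_piFinset]
    refine ⟨Finset.univ.filter fun i => x i ≠ y i, hy, fun i => ?_⟩
    by_cases hi : x i = y i <;> simp [hi]
  refine (Finset.card_le_card hsub).trans ?_
  -- There are at most `2 ^ M` disagreement sets `T`, each allowing `(4h²) ^ |T| = (2h) ^ (2|T|) ≤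
  -- (2h) ^ M` words.
  refine (Finset.card_biUnion_le_card_mul _ _ ((2 * h) ^ M) fun T hT => ?_).trans ?_
  · simp only [Finset.mem_filter, Finset.mem_univ, true_and] at hT
    rw [Fintype.card_piFinset]
    have : ∀ i, (if i ∈ T then (Finset.univ : Finset (Fin (4 * h ^ 2))) else {x i}).card =
        if i ∈ T then 4 * h ^ 2 else 1 := fun i => by split_ifs <;> simp
    simp_rw [this]
    rw [Finset.prod_ite_mem, Finset.univ_inter, Finset.prod_const,
      show 4 * h ^ 2 = (2 * h) ^ 2 by ring, ← pow_mul]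
    exact Nat.pow_le_pow_right (by omega) hT.le
  · refine Nat.mul_le_mul_right _ ((Finset.card_filter_le _ _).trans ?_)
    simp

/-- A packing of `h ^ M` words of length `M` over an alphabet with `4 h²` letters, any two of which
differ in at least half of the positions. -/
theorem exists_packing (M h n : ℕ) (hn : n ≤ h ^ M) :
    ∃ s : Finset (Fin M → Fin (4 * h ^ 2)), s.card = n ∧
      (s : Set (Fin M → Fin (4 * h ^ 2))).Pairwise fun x y => M ≤ 2 * hammingDist x y := by
  classical
  induction n with
  | zero => exact ⟨∅, by simp⟩
  | succ n ih =>
    obtain ⟨s, hs, hp⟩ := ih (by omega)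
    rcases Nat.eq_zero_or_pos M with rfl | hM
    · have : n = 0 := by simp at hn; omega
      subst this
      exact ⟨{fun i => i.elim0}, by simp⟩
    have h0 : 0 < h := by
      rcases Nat.eq_zero_or_pos h with rfl | h0
      · rw [zero_pow hM.ne'] at hn; omega
      · exact h0
    -- Greedy choice: since `4h² = h * 2 * (2h)`, fewer than `h ^ M` balls cannot cover all words.
    have hcard : (s.biUnion fun x => Finset.univ.filter fun y => 2 * hammingDist x y < M).card <
        (Finset.univ : Finset (Fin M → Fin (4 * h ^ 2))).card := by
      refine (Finset.card_biUnion_le_card_mul _ _ (2 ^ M * (2 * h) ^ M)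
        fun x _ => card_hammingBall_le h0 x).trans_lt ?_
      have : (Finset.univ : Finset (Fin M → Fin (4 * h ^ 2))).card =
          h ^ M * (2 ^ M * (2 * h) ^ M) := by
        simp only [Finset.card_univ, Fintype.card_fun, Fintype.card_fin, ← mul_pow]
        congr 1; ring
      rw [this, hs]
      exact Nat.mul_lt_mul_of_pos_right (by omega) (by positivity)
    obtain ⟨x, -, hx⟩ := Finset.exists_mem_notMem_of_card_lt_card hcard
    simp only [Finset.mem_biUnion, Finset.mem_filter, Finset.mem_univ, true_and, not_exists,
      not_and, not_lt] at hx
    have hxs : x ∉ s := fun h => by have := hx x h; simp at this; omega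
    refine ⟨insert x s, by simp [hxs, hs], ?_⟩
    rw [Finset.coe_insert]
    refine hp.insert fun y hy _ => ⟨?_, hx y hy⟩
    rw [hammingDist_comm]
    exact hx y hy

theorem exists_pairwise_hammingDist (M h n : ℕ) (hn : n ≤ h ^ M) :
    ∃ c : Fin n → Fin M → Fin (4 * h ^ 2), Function.Injective c ∧
      Pairwise fun m m' => M ≤ 2 * hammingDist (c m) (c m') := by
  obtain ⟨s, hs, hp⟩ := exists_packing M h n hn
  let e := s.equivFinOfCardEq hs
  have hinj : Function.Injective fun m => (e.symm m : Fin M → Fin (4 * h ^ 2)) :=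
    Subtype.val_injective.comp e.symm.injective
  exact ⟨fun m => e.symm m, hinj,
    fun m m' hm => hp (e.symm m).2 (e.symm m').2 (hinj.ne hm)⟩

/-! ### A lower bound for the Kullback–Leibler divergence -/

/-- Fenchel–Young inequality: the convex conjugate of `klFun` is `exp s - 1`. -/
theorem mul_le_klFun_add {s x : ℝ} (hx : 0 ≤ x) :
    s * x ≤ klFun x + (Real.exp s - 1) := by
  rw [klFun_apply]
  rcases hx.eq_or_lt with rfl | hx
  · simp; positivity
  · have h := Real.add_one_le_exp (s - Real.log x)
    rw [Real.exp_sub, Real.exp_log hx, le_div_iff₀ hx] at h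
    linarith

theorem mul_measure_le_klDiv_add {α : Type*} {mα : MeasurableSpace α} (μ ν : Measure α)
    [IsFiniteMeasure μ] [IsFiniteMeasure ν] {s : ℝ} (hs : 0 ≤ s) (E : Set α) :
    ENNReal.ofReal s * μ E ≤ klDiv μ ν + ENNReal.ofReal (Real.exp s - 1) * ν E := by
  by_cases hμν : μ ≪ ν
  swap
  · simp [klDiv_of_not_ac hμν]
  have hexp : 0 ≤ Real.exp s - 1 := by linarith [Real.one_le_exp hs]
  calc ENNReal.ofReal s * μ E
      = ∫⁻ x in E, ENNReal.ofReal s * μ.rnDeriv ν x ∂ν := by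
        rw [lintegral_const_mul _ (Measure.measurable_rnDeriv _ _),
          Measure.setLIntegral_rnDeriv hμν]
    _ ≤ ∫⁻ x in E, (ENNReal.ofReal (klFun (μ.rnDeriv ν x).toReal) +
          ENNReal.ofReal (Real.exp s - 1)) ∂ν := by
        refine lintegral_mono_ae (ae_restrict_of_ae ?_)
        filter_upwards [Measure.rnDeriv_lt_top μ ν] with x hx
        rw [← ENNReal.ofReal_add (klFun_nonneg ENNReal.toReal_nonneg) hexp]
        conv_lhs => rw [← ENNReal.ofReal_toReal hx.ne]
        rw [← ENNReal.ofReal_mul hs]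
        exact ENNReal.ofReal_le_ofReal (mul_le_klFun_add ENNReal.toReal_nonneg)
    _ = ∫⁻ x in E, ENNReal.ofReal (klFun (μ.rnDeriv ν x).toReal) ∂ν +
          ENNReal.ofReal (Real.exp s - 1) * ν E := by
        rw [lintegral_add_right _ measurable_const, setLIntegral_const]
    _ ≤ _ := by
        rw [klDiv_eq_lintegral_klFun_of_ac hμν]
        gcongr
        exact Measure.restrict_le_self

/-! ### Codeword covariances -/

section Matrices

open Matrix

variable {ι n : Type*} [DecidableEq ι]

/-- The matrix whose `i`-th column is `e_{p i} + a_i e_{q i}`. -/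
noncomputable def directionMatrix (p q : n → ι) (a : n → ℝ) : Matrix ι n ℝ :=
  Matrix.of fun j i => (if j = p i then 1 else 0) + a i * (if j = q i then 1 else 0)

/-- The covariance matrix `(1/κ) I + (1/4) ∑ i, u_i u_iᵀ`, where `u_i = e_{p i} + a_i e_{q i}`. -/
noncomputable def codeMatrix [Fintype n] (κ : ℝ) (p q : n → ι) (a : n → ℝ) : Matrix ι ι ℝ :=
  (1 / κ) • (1 : Matrix ι ι ℝ) +
    (1 / 4 : ℝ) • (directionMatrix p q a * (directionMatrix p q a)ᵀ)

theorem posSemidef_directionMatrix_mul [Fintype ι] [Fintype n] (p q : n → ι) (a : n → ℝ) :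
    (directionMatrix p q a * (directionMatrix p q a)ᵀ).PosSemidef := by
  simpa [conjTranspose_eq_transpose_of_trivial] using
    Matrix.posSemidef_self_mul_conjTranspose (directionMatrix p q a)

theorem transpose_directionMatrix_mulVec [Fintype ι] (p q : n → ι) (a : n → ℝ) (x : ι → ℝ) (i : n) :
    ((directionMatrix p q a)ᵀ *ᵥ x) i = x (p i) + a i * x (q i) := by
  simp [Matrix.mulVec, dotProduct, directionMatrix, add_mul, Finset.sum_add_distrib]

/-- Because the pairs are disjoint and the slopes are at most `1`, the sum of the `u_i u_iᵀ` has
quadratic form at most `2 |x|²`. The factor `1/4` leaves room `1/2` for the term `1/κ`. -/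
theorem posSemidef_one_sub_codeMatrix [Fintype ι] [Fintype n] {κ : ℝ} (hκ : 2 ≤ κ) {p q : n → ι} {a : n → ℝ}
    (hpq : Function.Injective (Sum.elim p q)) (ha : ∀ i, a i ∈ Set.Icc (0 : ℝ) 1) :
    ((1 : Matrix ι ι ℝ) - codeMatrix κ p q a).PosSemidef := by
  have hκ' : 1 / κ ≤ 1 / 2 := one_div_le_one_div_of_le two_pos hκ
  refine PosSemidef.of_dotProduct_mulVec_nonneg ?_ fun x => ?_
  · refine isHermitian_one.sub (IsHermitian.add ?_ ?_)
    · simp [IsHermitian]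
    · simp [IsHermitian]
  · have hsum : ∑ i, (x (p i) ^ 2 + x (q i) ^ 2) ≤ ∑ j, x j ^ 2 := by
      have h1 : ∑ s : n ⊕ n, x (Sum.elim p q s) ^ 2 ≤ ∑ j, x j ^ 2 := by
        rw [← Finset.sum_image (f := fun j => x j ^ 2) (g := Sum.elim p q) hpq.injOn]
        exact Finset.sum_le_sum_of_subset_of_nonneg (Finset.subset_univ _)
          fun _ _ _ => sq_nonneg _
      simpa [Fintype.sum_sum_type, Finset.sum_add_distrib] using h1
    have hquad : x ⬝ᵥ ((directionMatrix p q a * (directionMatrix p q a)ᵀ) *ᵥ x) =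
        ∑ i, (x (p i) + a i * x (q i)) ^ 2 := by
      rw [← mulVec_mulVec, dotProduct_mulVec, ← mulVec_transpose]
      simp only [dotProduct, transpose_directionMatrix_mulVec, sq]
    have hle : ∑ i, (x (p i) + a i * x (q i)) ^ 2 ≤ 2 * ∑ i, (x (p i) ^ 2 + x (q i) ^ 2) := by
      rw [Finset.mul_sum]
      refine Finset.sum_le_sum fun i _ => ?_
      have h2 : a i ^ 2 ≤ 1 := by nlinarith [(ha i).1, (ha i).2]
      nlinarith [sq_nonneg (x (p i) - a i * x (q i)), sq_nonneg (x (q i)),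
        mul_nonneg (sub_nonneg.2 h2) (sq_nonneg (x (q i)))]
    have hxx : x ⬝ᵥ x = ∑ j, x j ^ 2 := by simp [dotProduct, sq]
    rw [star_trivial, sub_mulVec, dotProduct_sub, one_mulVec, codeMatrix, add_mulVec, smul_mulVec,
      smul_mulVec, one_mulVec, dotProduct_add, dotProduct_smul, dotProduct_smul, hquad, hxx]
    simp only [smul_eq_mul]
    nlinarith [Finset.sum_nonneg (s := Finset.univ) fun j _ => sq_nonneg (x j)]

theorem codeMatrix_apply_left [Fintype n] [DecidableEq n] {p q : n → ι}
    (hpq : Function.Injective (Sum.elim p q)) (κ : ℝ) (a : n → ℝ) (i : n) : codeMatrix κ p q a (p i) (p i) = 1 / κ + 1 / 4 := by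
  have h1 : ∀ j k, p j = p k ↔ j = k := fun j k => (hpq.comp Sum.inl_injective).eq_iff
  have h2 : ∀ j k, p j ≠ q k := fun j k h => by simpa using @hpq (.inl j) (.inr k) h
  simp [codeMatrix, Matrix.mul_apply, directionMatrix, h1, h2]

theorem codeMatrix_apply_right [Fintype n] [DecidableEq n] {p q : n → ι}
    (hpq : Function.Injective (Sum.elim p q)) (κ : ℝ) (a : n → ℝ) (i : n) : codeMatrix κ p q a (q i) (q i) = 1 / κ + a i ^ 2 / 4 := by
  have h1 : ∀ j k, q j = q k ↔ j = k := fun j k => (hpq.comp Sum.inr_injective).eq_iff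
  have h2 : ∀ j k, q j ≠ p k := fun j k h => by simpa using @hpq (.inr j) (.inl k) h
  simp [codeMatrix, Matrix.mul_apply, directionMatrix, h1, h2]
  ring

theorem codeMatrix_apply_right_left [Fintype n] [DecidableEq n] {p q : n → ι}
    (hpq : Function.Injective (Sum.elim p q)) (κ : ℝ) (a : n → ℝ) (i : n) : codeMatrix κ p q a (q i) (p i) = a i / 4 := by
  have h0 : ∀ j k, p j = p k ↔ j = k := fun j k => (hpq.comp Sum.inl_injective).eq_iff
  have h1 : ∀ j k, q j = q k ↔ j = k := fun j k => (hpq.comp Sum.inr_injective).eq_iff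
  have h2 : ∀ j k, q j ≠ p k := fun j k h => by simpa using @hpq (.inr j) (.inl k) h
  have h3 : ∀ j k, p j ≠ q k := fun j k h => (h2 k j h.symm).elim
  simp [codeMatrix, Matrix.mul_apply, directionMatrix, h0, h1, h2, h3]
  ring

end Matrices

theorem codeMatrix_mem_covarianceSet {d M : ℕ} {κ : ℝ} (hκ : 2 ≤ κ) {p q : Fin M → Fin d}
    {a : Fin M → ℝ} (hpq : Function.Injective (Sum.elim p q))
    (ha : ∀ i, a i ∈ Set.Icc (0 : ℝ) 1) : codeMatrix κ p q a ∈ covarianceSet d κ := by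
  have h1 := (posSemidef_directionMatrix_mul p q a).smul (show (0 : ℝ) ≤ 1 / 4 by norm_num)
  refine ⟨(Matrix.PosSemidef.one.smul (show (0 : ℝ) ≤ 1 / κ by positivity)).add h1, ?_,
    posSemidef_one_sub_codeMatrix hκ hpq ha⟩
  rwa [codeMatrix, add_sub_cancel_left]

/-! ### Probability of a symbol error -/

theorem gaussianReal_abs_le_le {v : NNReal} (hv : 1 / 4 ≤ v) (τ : ℝ) :
    gaussianReal 0 v {x | |x| ≤ τ} ≤ ENNReal.ofReal (2 * τ) := by
  have hv' : (1 / 4 : ℝ) ≤ v := by exact_mod_cast hv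
  have hv0 : v ≠ 0 := fun h => by norm_num [h] at hv'
  -- The density is at most `1` because `2 π v ≥ 1`.
  have hpdf : ∀ x, gaussianPDF 0 v x ≤ 1 := fun x => by
    rw [gaussianPDF, ENNReal.ofReal_le_one, gaussianPDFReal]
    refine mul_le_one₀ (inv_le_one_of_one_le₀ ?_) (Real.exp_nonneg _) ?_
    · rw [Real.one_le_sqrt]
      nlinarith [Real.pi_gt_three]
    · rw [Real.exp_le_one_iff]
      exact div_nonpos_of_nonpos_of_nonneg (by nlinarith [sq_nonneg (x - 0)]) (by positivity)
  have hset : {x : ℝ | |x| ≤ τ} = Set.Icc (-τ) τ := by ext x; simp [abs_le]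
  rw [gaussianReal_apply _ hv0]
  calc ∫⁻ x in {x : ℝ | |x| ≤ τ}, gaussianPDF 0 v x
      ≤ ∫⁻ _ in {x : ℝ | |x| ≤ τ}, 1 := lintegral_mono hpdf
    _ = ENNReal.ofReal (2 * τ) := by
        rw [setLIntegral_one, hset, Real.volume_Icc]
        congr 1; ring

/-- The event that the slope `y_{q} / y_{p}` is not within `1 / (2 Q)` of `a`. -/
def symbolError {d : ℕ} (p q : Fin d) (Q a : ℝ) : Set (EuclideanSpace ℝ (Fin d)) :=
  {y | |y p| ≤ 2 * Q * |y q - a * y p|}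

theorem measurableSet_symbolError {d : ℕ} (p q : Fin d) (Q a : ℝ) :
    MeasurableSet (symbolError p q Q a) :=
  measurableSet_le (by fun_prop) (by fun_prop)

/-- An error needs either `|y_p| ≤ τ`, unlikely by the density bound, or a residual `y_q - a y_p` of
size at least `τ / (2Q)`, unlikely by Chebyshev with variance at most `2/κ`. -/
theorem gaussianLaw_symbolError_le {d M : ℕ} {κ : ℝ} (hκ : 2 ≤ κ) {p q : Fin M → Fin d}
    {a : Fin M → ℝ} (hpq : Function.Injective (Sum.elim p q))
    (ha : ∀ i, a i ∈ Set.Icc (0 : ℝ) 1) (i : Fin M) {Q τ : ℝ} (hQ : 0 < Q) (hτ : 0 < τ) :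
    gaussianLaw (codeMatrix κ p q a) (symbolError (p i) (q i) Q (a i)) ≤
      ENNReal.ofReal (2 * τ + 8 * Q ^ 2 / (κ * τ ^ 2)) := by
  set S := codeMatrix κ p q a with hS
  have hpos : S.PosSemidef := (codeMatrix_mem_covarianceSet hκ hpq ha).1
  set P := multivariateGaussian (0 : EuclideanSpace ℝ (Fin d)) S with hP
  have hsub : symbolError (p i) (q i) Q (a i) ⊆
      {y | |y (p i)| ≤ τ} ∪ {y | τ / (2 * Q) ≤ |y (q i) - a i * y (p i)|} := by
    intro y hy
    by_contra hcon
    simp only [Set.mem_union, Set.mem_ofPred_eq, not_or, not_le] at hcon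
    have h1 := hcon.2
    rw [lt_div_iff₀ (by positivity)] at h1
    have hy' : |y (p i)| ≤ 2 * Q * |y (q i) - a i * y (p i)| := hy
    linarith [hcon.1]
  have hsmall : P {y | |y (p i)| ≤ τ} ≤ ENNReal.ofReal (2 * τ) := by
    have hmp := measurePreserving_eval_multivariateGaussian (μ := 0) hpos (i := p i)
    have := hmp.measure_preimage (s := {x : ℝ | |x| ≤ τ})
      (measurableSet_le (by fun_prop) (by fun_prop)).nullMeasurableSet
    rw [Set.preimage_ofPred_eq] at this
    rw [this]
    refine gaussianReal_abs_le_le ?_ τ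
    rw [Real.le_toNNReal_iff_coe_le (hpos.diag_nonneg), hS, codeMatrix_apply_left hpq]
    have : 0 ≤ 1 / κ := by positivity
    push_cast
    linarith
  have hmem : ∀ j, MemLp (fun y : EuclideanSpace ℝ (Fin d) => y j) 2 P := fun j =>
    (EuclideanSpace.proj (𝕜 := ℝ) j).comp_memLp' IsGaussian.memLp_two_id
  have hmean : ∀ j, ∫ y, y j ∂P = 0 := fun j => by
    have := (EuclideanSpace.proj (𝕜 := ℝ) j).integral_comp_comm
      (μ := P) (φ := fun y => y) IsGaussian.integrable_id
    simpa [hP] using this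
  have hmem' : MemLp (fun y : EuclideanSpace ℝ (Fin d) => a i * y (p i)) 2 P :=
    (hmem _).const_mul _
  have hlarge : P {y | τ / (2 * Q) ≤ |y (q i) - a i * y (p i)|} ≤
      ENNReal.ofReal (8 * Q ^ 2 / (κ * τ ^ 2)) := by
    have hcheb := meas_ge_le_variance_div_sq ((hmem (q i)).sub hmem')
      (c := τ / (2 * Q)) (by positivity)
    have hexp : ∫ y : EuclideanSpace ℝ (Fin d),
        ((fun y : EuclideanSpace ℝ (Fin d) => y (q i)) -
          fun y : EuclideanSpace ℝ (Fin d) => a i * y (p i)) y ∂P = 0 := by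
      simp only [Pi.sub_apply]
      rw [integral_sub ((hmem _).integrable one_le_two) (hmem'.integrable one_le_two),
        integral_const_mul, hmean, hmean]
      simp
    -- The rank-one part cancels in this combination, leaving only the `1/κ` noise.
    have hvar : Var[(fun y : EuclideanSpace ℝ (Fin d) => y (q i)) -
          fun y : EuclideanSpace ℝ (Fin d) => a i * y (p i); P] = (1 + a i ^ 2) / κ := by
      rw [variance_sub (hmem _) hmem', variance_const_mul, covariance_const_mul_right,
        variance_eval_multivariateGaussian hpos, variance_eval_multivariateGaussian hpos,
        covariance_eval_multivariateGaussian hpos, hS, codeMatrix_apply_left hpq,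
        codeMatrix_apply_right hpq, codeMatrix_apply_right_left hpq]
      ring
    rw [hexp, hvar] at hcheb
    simp only [Pi.sub_apply, sub_zero] at hcheb
    refine hcheb.trans (ENNReal.ofReal_le_ofReal ?_)
    have h2 : a i ^ 2 ≤ 1 := by nlinarith [(ha i).1, (ha i).2]
    have hκ0 : 0 < κ := by linarith
    rw [div_pow, div_div_eq_mul_div, div_mul_eq_mul_div, div_div,
      div_le_div_iff_of_pos_right (by positivity)]
    nlinarith [sq_nonneg Q, mul_nonneg (sub_nonneg.2 h2) (sq_nonneg Q)]
  calc gaussianLaw S (symbolError (p i) (q i) Q (a i))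
      ≤ P ({y | |y (p i)| ≤ τ} ∪ {y | τ / (2 * Q) ≤ |y (q i) - a i * y (p i)|}) :=
        measure_mono hsub
    _ ≤ ENNReal.ofReal (2 * τ) + ENNReal.ofReal (8 * Q ^ 2 / (κ * τ ^ 2)) :=
        (measure_union_le _ _).trans (add_le_add hsmall hlarge)
    _ = _ := (ENNReal.ofReal_add (by positivity) (by positivity)).symm

/-! ### The code -/

/-- Grid slopes are `1/Q` apart, so at most one lies strictly within `1/(2Q)` of `y_q / y_p`. -/
theorem eq_of_notMem_symbolError {d Q : ℕ} {p q : Fin d} {j j' : Fin Q}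
    {y : EuclideanSpace ℝ (Fin d)} (h : y ∉ symbolError p q Q ((j : ℝ) / Q))
    (h' : y ∉ symbolError p q Q ((j' : ℝ) / Q)) : j = j' := by
  have hQ : (0 : ℝ) < Q := by exact_mod_cast j.pos
  have h1 : 2 * Q * |y q - (j : ℝ) / Q * y p| < |y p| := not_le.1 h
  have h2 : 2 * Q * |y q - (j' : ℝ) / Q * y p| < |y p| := not_le.1 h'
  have h3 : |(j : ℝ) - j'| * |y p| < |y p| := by
    have heq : ((j : ℝ) - j') * y p =
        Q * ((y q - (j' : ℝ) / Q * y p) - (y q - (j : ℝ) / Q * y p)) := by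
      field_simp; ring
    rw [← abs_mul, heq, abs_mul, abs_of_pos hQ]
    nlinarith [abs_sub (y q - (j' : ℝ) / Q * y p) (y q - (j : ℝ) / Q * y p)]
  have hy : 0 < |y p| := lt_of_le_of_lt (by positivity) h1
  have h4 : |(j : ℝ) - j'| < 1 := by
    by_contra hcon
    nlinarith [not_lt.1 hcon]
  have h5 : |((j : ℕ) : ℤ) - ((j' : ℕ) : ℤ)| < 1 := by exact_mod_cast h4
  rw [Int.abs_lt_one_iff] at h5
  exact Fin.ext (by omega)

/-- The number of positions at which the word `a` fails to explain the output `y`. -/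
noncomputable def errorCount {d M : ℕ} (p q : Fin M → Fin d) (Q : ℝ) (a : Fin M → ℝ)
    (y : EuclideanSpace ℝ (Fin d)) : ℝ≥0∞ :=
  ∑ i, (symbolError (p i) (q i) Q (a i)).indicator 1 y

theorem measurable_errorCount {d M : ℕ} (p q : Fin M → Fin d) (Q : ℝ) (a : Fin M → ℝ) :
    Measurable (errorCount p q Q a) :=
  Finset.measurable_sum _ fun _ _ =>
    measurable_one.indicator (measurableSet_symbolError _ _ _ _)

theorem gaussianLaw_le_errorCount_le {d M : ℕ} {κ : ℝ} (hκ : 2 ≤ κ) (hM : 0 < M)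
    {p q : Fin M → Fin d} {a : Fin M → ℝ} (hpq : Function.Injective (Sum.elim p q))
    (ha : ∀ i, a i ∈ Set.Icc (0 : ℝ) 1) {Q τ : ℝ} (hQ : 0 < Q) (hτ : 0 < τ) :
    gaussianLaw (codeMatrix κ p q a) {y | (M : ℝ≥0∞) ≤ 4 * errorCount p q Q a y} ≤
      ENNReal.ofReal (4 * (2 * τ + 8 * Q ^ 2 / (κ * τ ^ 2))) := by
  set P := gaussianLaw (codeMatrix κ p q a)
  set δ := ENNReal.ofReal (2 * τ + 8 * Q ^ 2 / (κ * τ ^ 2)) with hδ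
  have hM0 : (M : ℝ≥0∞) ≠ 0 := by exact_mod_cast hM.ne'
  have h1 : (M : ℝ≥0∞) * P {y | (M : ℝ≥0∞) ≤ 4 * errorCount p q Q a y} ≤ M * (4 * δ) := by
    refine (mul_meas_ge_le_lintegral ((measurable_errorCount p q Q a).const_mul 4) _).trans ?_
    rw [lintegral_const_mul _ (measurable_errorCount p q Q a)]
    simp only [errorCount]
    rw [lintegral_finsetSum _ fun _ _ =>
      measurable_one.indicator (measurableSet_symbolError _ _ _ _)]
    simp only [lintegral_indicator_one (measurableSet_symbolError _ _ _ _)]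
    calc 4 * ∑ i, P (symbolError (p i) (q i) Q (a i))
        ≤ 4 * ∑ _i : Fin M, δ := by
          gcongr with i
          exact gaussianLaw_symbolError_le hκ hpq ha i hQ hτ
      _ = M * (4 * δ) := by simp; ring
  rw [ENNReal.mul_le_mul_iff_right hM0 (ENNReal.natCast_ne_top M)] at h1
  rwa [ENNReal.ofReal_mul (by norm_num), ENNReal.ofReal_ofNat]

theorem hammingDist_le_of_errorCount_lt {d M Q : ℕ} {p q : Fin M → Fin d} {w w' : Fin M → Fin Q}
    {y : EuclideanSpace ℝ (Fin d)}
    (h : 4 * errorCount p q Q (fun i => (w i : ℝ) / Q) y < M)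
    (h' : 4 * errorCount p q Q (fun i => (w' i : ℝ) / Q) y < M) :
    2 * hammingDist w w' < M := by
  classical
  have hcard : ∀ v : Fin M → Fin Q, errorCount p q Q (fun i => (v i : ℝ) / Q) y =
      ((Finset.univ.filter fun i => y ∈ symbolError (p i) (q i) Q ((v i : ℝ) / Q)).card : ℝ≥0∞) :=
    fun v => by simp [errorCount, Set.indicator_apply]
  rw [hcard] at h h'
  norm_cast at h h'
  have hsub : (Finset.univ.filter fun i => w i ≠ w' i) ⊆
      (Finset.univ.filter fun i => y ∈ symbolError (p i) (q i) Q ((w i : ℝ) / Q)) ∪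
      (Finset.univ.filter fun i => y ∈ symbolError (p i) (q i) Q ((w' i : ℝ) / Q)) := by
    intro i hi
    by_contra hcon
    simp only [Finset.mem_union, Finset.mem_filter, Finset.mem_univ, true_and, not_or] at hi hcon
    exact hi (eq_of_notMem_symbolError hcon.1 hcon.2)
  have hle : hammingDist w w' ≤ _ := (Finset.card_le_card hsub).trans (Finset.card_union_le _ _)
  omega

theorem averageError_le {d k : ℕ} {κ : ℝ} {C : Code d κ k} {ε : ℝ≥0∞}
    (h : ∀ m, channel d κ (C.encode m) {y | C.decode y ≠ m} ≤ ε) : C.averageError ≤ ε := by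
  rw [Code.averageError]
  refine ENNReal.div_le_of_le_mul' ((Finset.sum_le_sum fun m _ => h m).trans ?_)
  simp

theorem exists_code {d M h k : ℕ} {κ τ : ℝ} (hκ : 2 ≤ κ) (hM : 0 < M) (hMd : 2 * M ≤ d)
    (hk : 2 ^ k ≤ h ^ M) (hτ : 0 < τ) :
    ∃ C : Code d κ k, Function.Injective C.encode ∧
      C.averageError ≤ ENNReal.ofReal (4 * (2 * τ + 128 * (h : ℝ) ^ 4 / (κ * τ ^ 2))) := by
  have h0 : 0 < h := by
    rcases Nat.eq_zero_or_pos h with rfl | h0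
    · rw [zero_pow hM.ne'] at hk
      exact absurd hk (Nat.two_pow_pos k).not_ge
    · exact h0
  obtain ⟨c, hc, hdist⟩ := exists_pairwise_hammingDist M h (2 ^ k) hk
  let p : Fin M → Fin d := fun i => ⟨i, by omega⟩
  let q : Fin M → Fin d := fun i => ⟨M + i, by omega⟩
  have hpq : Function.Injective (Sum.elim p q) := by
    rintro (i | i) (j | j) hij <;> simp [p, q, Fin.ext_iff] at hij ⊢ <;> omega
  let Q : ℕ := 4 * h ^ 2
  have hQ : (0 : ℝ) < (Q : ℕ) := by exact_mod_cast (by positivity : 0 < 4 * h ^ 2)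
  let a : Fin (2 ^ k) → Fin M → ℝ := fun m i => (c m i : ℝ) / (Q : ℕ)
  have ha : ∀ m i, a m i ∈ Set.Icc (0 : ℝ) 1 := fun m i =>
    ⟨by positivity, (div_le_one hQ).2 (by exact_mod_cast (c m i).2.le)⟩
  have hainj : Function.Injective a := fun m m' hmm => hc <| funext fun i => by
    have h1 : (c m i : ℝ) / (Q : ℕ) = (c m' i : ℝ) / (Q : ℕ) := congrFun hmm i
    rw [div_left_inj' hQ.ne'] at h1
    exact Fin.ext (by exact_mod_cast h1)
  let t : Fin (2 ^ k) → Set (EuclideanSpace ℝ (Fin d)) := fun m =>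
    {y | 4 * errorCount p q (Q : ℕ) (a m) y < M}
  have ht : ∀ m, MeasurableSet (t m) := fun m =>
    measurableSet_lt ((measurable_errorCount _ _ _ _).const_mul 4) measurable_const
  -- The acceptance regions `t m` are pairwise disjoint by the minimum distance, so the decoder is
  -- well defined on them.
  obtain ⟨D, hD, hDt⟩ := exists_measurable_piecewise t ht (fun m _ => m)
    (fun _ => measurable_const) fun m m' hmm y hy => by
      have h1 := hammingDist_le_of_errorCount_lt hy.1 hy.2
      have h2 := hdist hmm
      omega
  refine ⟨⟨fun m => ⟨codeMatrix κ p q (a m), codeMatrix_mem_covarianceSet hκ hpq (ha m)⟩, D, hD⟩,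
    fun m m' hmm => hainj <| funext fun i => ?_, averageError_le fun m => ?_⟩
  -- The off-diagonal entry `a_i / 4` recovers the slope.
  · have h1 := congrFun (congrFun (congrArg Subtype.val hmm) (q i)) (p i)
    simp only [codeMatrix_apply_right_left hpq] at h1
    linarith
  · refine (measure_mono (t := {y | (M : ℝ≥0∞) ≤ 4 * errorCount p q (Q : ℕ) (a m) y})
      fun y hy => ?_).trans ((gaussianLaw_le_errorCount_le hκ hM hpq (ha m) hQ hτ).trans_eq ?_)
    · by_contra hcon
      rw [Set.mem_ofPred_eq, not_le] at hcon
      exact hy (hDt m hcon)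
    · congr 3
      simp only [Q]
      push_cast
      ring

theorem exists_code_of_le_logb {ρ : ℝ} (hρ : 0 < ρ) (hρ1 : ρ < 1) {d : ℕ} {κ : ℝ} (hd : 2 ≤ d)
    (hκ : (520 / ρ) ^ 32 ≤ κ) {k : ℕ} (hk : (k : ℝ) ≤ 1 / 96 * d * Real.logb 2 κ) :
    ∃ C : Code d κ k, Function.Injective C.encode ∧ C.averageError ≤ ENNReal.ofReal ρ := by
  have hρ' : 520 ≤ 520 / ρ := by rw [le_div_iff₀ hρ]; linarith
  have hκ0 : 0 ≤ κ := le_trans (by positivity) hκ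
  -- With `κ = u ^ 32`, `h ≈ u ^ 2` and `τ = u ^ (-8)`, both error terms are of order `u ^ (-8)`,
  -- and `4 * (2 + 128) = 520`.
  obtain ⟨u, hu, huκ⟩ : ∃ u : ℝ, 520 / ρ ≤ u ∧ κ = u ^ 32 := by
    refine ⟨κ ^ ((32 : ℕ) : ℝ)⁻¹, ?_, (Real.rpow_inv_natCast_pow hκ0 (by norm_num)).symm⟩
    rw [Real.le_rpow_inv_iff_of_pos (by positivity) hκ0 (by norm_num), Real.rpow_natCast]
    exact hκ
  have hu1 : 520 ≤ u := hρ'.trans hu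
  have hu0 : 0 < u := by linarith
  set h := ⌊u ^ 2⌋₊ with hh
  have hh1 : (h : ℝ) ≤ u ^ 2 := Nat.floor_le (by positivity)
  have hh2 : u ≤ h := by nlinarith [Nat.lt_floor_add_one (u ^ 2)]
  have hM : (d : ℝ) ≤ 3 * (d / 2 : ℕ) := by exact_mod_cast (by omega : d ≤ 3 * (d / 2))
  have hlog : 0 ≤ Real.logb 2 u := Real.logb_nonneg one_lt_two (by linarith)
  -- The rate constant is `1/96 = (1/32) * (1/3)`: the first factor from `κ = u ^ 32`, the second
  -- from `d ≤ 3 (d / 2)`.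
  have hpow : 2 ^ k ≤ h ^ (d / 2) := by
    have h1 : (k : ℝ) ≤ Real.logb 2 (u ^ (d / 2)) := by
      rw [huκ, Real.logb_pow] at hk
      rw [Real.logb_pow]
      push_cast at hk
      nlinarith
    rw [Real.le_logb_iff_rpow_le one_lt_two (by positivity), Real.rpow_natCast] at h1
    have h2 : (2 : ℝ) ^ k ≤ (h : ℝ) ^ (d / 2) := h1.trans (by gcongr)
    exact_mod_cast h2
  have hκ2 : 2 ≤ κ := by
    rw [huκ]
    calc (2 : ℝ) ≤ u := by linarith
      _ ≤ u ^ 32 := le_self_pow₀ (by linarith) (by norm_num)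
  obtain ⟨C, hC, hCe⟩ := exists_code (τ := (u ^ 8)⁻¹) hκ2 (by omega : 0 < d / 2)
    (by omega : 2 * (d / 2) ≤ d) hpow (by positivity)
  refine ⟨C, hC, hCe.trans (ENNReal.ofReal_le_ofReal ?_)⟩
  have h4 : (h : ℝ) ^ 4 ≤ u ^ 8 := by
    calc (h : ℝ) ^ 4 ≤ (u ^ 2) ^ 4 := by gcongr
      _ = u ^ 8 := by ring
  calc 4 * (2 * (u ^ 8)⁻¹ + 128 * (h : ℝ) ^ 4 / (κ * (u ^ 8)⁻¹ ^ 2))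
      ≤ 4 * (2 * (u ^ 8)⁻¹ + 128 * u ^ 8 / (κ * (u ^ 8)⁻¹ ^ 2)) := by gcongr
    _ = 520 / u ^ 8 := by rw [huκ]; field_simp; ring
    _ ≤ 520 / u := by
        gcongr
        exact le_self_pow₀ (by linarith) (by norm_num)
    _ ≤ ρ := by rw [div_le_iff₀ hu0]; rwa [div_le_iff₀' hρ] at hu

/-! ### From codes to mutual information -/

/-- The uniform distribution on the codewords. -/
noncomputable def Code.prior {d k : ℕ} {κ : ℝ} (C : Code d κ k) : Measure (Input d κ) :=
  (2 ^ k : ℝ≥0∞)⁻¹ • ∑ m, Measure.dirac (C.encode m)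

instance Code.isProbabilityMeasure_prior {d k : ℕ} {κ : ℝ} (C : Code d κ k) :
    IsProbabilityMeasure C.prior :=
  ⟨by simp [Code.prior, ENNReal.inv_mul_cancel]⟩

/-- The event that the decoder returns the input. -/
def Code.success {d k : ℕ} {κ : ℝ} (C : Code d κ k) :
    Set (Input d κ × EuclideanSpace ℝ (Fin d)) :=
  {x | C.encode (C.decode x.2) = x.1}

theorem Code.measurableSet_success {d k : ℕ} {κ : ℝ} (C : Code d κ k) :
    MeasurableSet C.success := by
  have : C.success = ⋃ m, {C.encode m} ×ˢ (C.decode ⁻¹' {m}) := by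
    ext x
    simp [Code.success, eq_comm]
  rw [this]
  exact MeasurableSet.iUnion fun m =>
    (measurableSet_singleton _).prod (C.measurable_decode (measurableSet_singleton m))

theorem Code.one_le_compProd_success_add {d k : ℕ} {κ : ℝ} (C : Code d κ k) :
    1 ≤ C.prior.compProd (channel d κ) C.success + C.averageError := by
  rw [Measure.compProd_apply C.measurableSet_success, Code.prior, lintegral_smul_measure,
    lintegral_finsetSum_measure, Code.averageError, ENNReal.div_eq_inv_mul, smul_eq_mul, ← mul_add,
    ← Finset.sum_add_distrib]
  have h1 : ∀ m, 1 ≤ (∫⁻ x, channel d κ x (Prod.mk x ⁻¹' C.success)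
      ∂Measure.dirac (C.encode m)) + channel d κ (C.encode m) {y | C.decode y ≠ m} := by
    intro m
    rw [lintegral_dirac' _ (Kernel.measurable_kernel_prodMk_left C.measurableSet_success)]
    calc (1 : ℝ≥0∞) = channel d κ (C.encode m) Set.univ := by simp
      _ ≤ channel d κ (C.encode m)
          ((Prod.mk (C.encode m) ⁻¹' C.success) ∪ {y | C.decode y ≠ m}) := by
        refine measure_mono fun y _ => ?_
        by_cases hy : C.decode y = m
        · exact Or.inl (congrArg C.encode hy)
        · exact Or.inr hy
      _ ≤ _ := measure_union_le _ _
  calc (1 : ℝ≥0∞) = (2 ^ k : ℝ≥0∞)⁻¹ * ∑ _m : Fin (2 ^ k), 1 := by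
        simp [ENNReal.inv_mul_cancel]
    _ ≤ _ := by gcongr with m; exact h1 m

/-- Given any output, an independent input must equal one specific codeword; injectivity makes its
prior mass exactly `2 ^ (-k)`. -/
theorem Code.prod_success {d k : ℕ} {κ : ℝ} (C : Code d κ k) (hC : Function.Injective C.encode)
    (Q : Measure (EuclideanSpace ℝ (Fin d))) [IsProbabilityMeasure Q] :
    C.prior.prod Q C.success = (2 ^ k : ℝ≥0∞)⁻¹ := by
  rw [Measure.prod_apply_symm C.measurableSet_success]
  have h1 : ∀ y, C.prior ((fun x => (x, y)) ⁻¹' C.success) = (2 ^ k : ℝ≥0∞)⁻¹ := by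
    intro y
    have : (fun x => (x, y)) ⁻¹' C.success = {C.encode (C.decode y)} := by
      ext x
      simp [Code.success, eq_comm]
    rw [this, Code.prior]
    simp [Set.indicator_apply, hC.eq_iff]
  simp [h1]

/-- Duality with `s = k log 2` on the success event: the exponential term costs `(2 ^ k - 1) * 2 ^
(-k) ≤ 1`. -/
theorem Code.le_mutualInformation {d k : ℕ} {κ : ℝ} (C : Code d κ k)
    (hC : Function.Injective C.encode) (he : C.averageError ≤ ENNReal.ofReal (1 / 2)) :
    ENNReal.ofReal (k * Real.log 2 / 2 - 1) ≤ mutualInformation C.prior (channel d κ) := by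
  have hs : 0 ≤ k * Real.log 2 := by positivity
  have h1 := mul_measure_le_klDiv_add (C.prior.compProd (channel d κ))
    (C.prior.prod (C.prior.bind (channel d κ))) hs C.success
  rw [C.prod_success hC, Real.exp_nat_mul, Real.exp_log two_pos] at h1
  have h2 : ENNReal.ofReal (2 ^ k - 1) * (2 ^ k : ℝ≥0∞)⁻¹ ≤ 1 := by
    rw [← div_eq_mul_inv]
    refine ENNReal.div_le_of_le_mul ?_
    rw [one_mul]
    refine (ENNReal.ofReal_le_ofReal (sub_le_self _ zero_le_one)).trans_eq ?_
    rw [ENNReal.ofReal_pow zero_le_two, ENNReal.ofReal_ofNat]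
  have h3 : ENNReal.ofReal (1 / 2) ≤ C.prior.compProd (channel d κ) C.success := by
    have h4 := C.one_le_compProd_success_add.trans (add_le_add_right he _)
    have h5 : (1 : ℝ≥0∞) = ENNReal.ofReal (1 / 2) + ENNReal.ofReal (1 / 2) := by
      rw [← ENNReal.ofReal_add (by norm_num) (by norm_num)]
      norm_num
    rw [h5] at h4
    exact (ENNReal.add_le_add_iff_right ENNReal.ofReal_ne_top).1 h4
  rw [ENNReal.ofReal_sub _ zero_le_one, ENNReal.ofReal_one, tsub_le_iff_right,
    div_eq_mul_one_div, ENNReal.ofReal_mul hs]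
  calc ENNReal.ofReal (k * Real.log 2) * ENNReal.ofReal (1 / 2)
      ≤ ENNReal.ofReal (k * Real.log 2) * C.prior.compProd (channel d κ) C.success := by gcongr
    _ ≤ _ := h1.trans (by gcongr; rfl)

theorem Code.le_capacityBits {d k : ℕ} {κ : ℝ} (C : Code d κ k)
    (hC : Function.Injective C.encode) (he : C.averageError ≤ ENNReal.ofReal (1 / 2)) :
    ENNReal.ofReal (k / 2 - 2) ≤ capacityBits d κ := by
  have hlog : 0 < Real.log 2 := Real.log_pos one_lt_two
  refine le_trans ?_ (le_iSup (fun P : ProbabilityMeasure (Input d κ) =>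
    mutualInformation (P : Measure (Input d κ)) (channel d κ) / ENNReal.ofReal (Real.log 2))
    ⟨C.prior, inferInstance⟩)
  rw [ENNReal.le_div_iff_mul_le (Or.inl (by simpa using hlog)) (Or.inl ENNReal.ofReal_ne_top),
    ← ENNReal.ofReal_mul' hlog.le]
  refine le_trans (ENNReal.ofReal_le_ofReal ?_) (C.le_mutualInformation hC he)
  -- The loss of `1` nat is at most `2` bits since `log 2 ≥ 1/2`.
  nlinarith [Real.log_two_gt_d9]

theorem le_capacityBits {d : ℕ} {κ : ℝ} (hd : 2 ≤ d) (hκ : 1040 ^ 32 ≤ κ)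
    (hκ' : 2 ^ 480 ≤ κ) :
    ENNReal.ofReal (1 / 384 * d * Real.logb 2 κ) ≤ capacityBits d κ := by
  have hκ0 : 0 < κ := lt_of_lt_of_le (by positivity) hκ
  have hlog : 480 ≤ Real.logb 2 κ := by
    rw [Real.le_logb_iff_rpow_le one_lt_two hκ0]
    exact_mod_cast hκ'
  have hd' : (2 : ℝ) ≤ d := by exact_mod_cast hd
  set x := 1 / 96 * d * Real.logb 2 κ with hx
  -- From `x ≥ 10` follows `(x - 1) / 2 - 2 ≥ x / 4`, which absorbs the floor and the additive loss;
  -- the threshold `2 ^ 480` ensures it when `d ≥ 2`.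
  have hx0 : 10 ≤ x := by nlinarith
  obtain ⟨C, hC, he⟩ := exists_code_of_le_logb (ρ := 1 / 2) (by norm_num) (by norm_num) hd
    (by norm_num at hκ ⊢; exact hκ) (k := ⌊x⌋₊) (Nat.floor_le (by linarith))
  refine le_trans (ENNReal.ofReal_le_ofReal ?_) (C.le_capacityBits hC he)
  have := Nat.lt_floor_add_one x
  linarith

end GaussianCovarianceChannel

theorem mainTheorem5 :
    (∀ ρ : ℝ, 0 < ρ → ρ < 1 →
      ∃ c : ℝ, 0 < c ∧ ∃ κρ : ℝ, ∀ (d : ℕ) (κ : ℝ), 2 ≤ d → κρ ≤ κ →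
        ∀ k : ℕ, (k : ℝ) ≤ c * d * Real.logb 2 κ →
          (∃ C : GaussianCovarianceChannel.Code d κ k, C.averageError ≤ ENNReal.ofReal ρ) ∧
            GaussianCovarianceChannel.oneShotError d κ k ≤ ENNReal.ofReal ρ) ∧
    (∃ c : ℝ, 0 < c ∧ ∃ κ₀ : ℝ, ∀ (d : ℕ) (κ : ℝ), 2 ≤ d → κ₀ ≤ κ →
      ENNReal.ofReal (c * d * Real.logb 2 κ) ≤
        GaussianCovarianceChannel.capacityBits d κ) := by
  refine ⟨fun ρ hρ hρ1 => ⟨1 / 96, by norm_num, (520 / ρ) ^ 32, fun d κ hd hκ k hk => ?_⟩,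
    1 / 384, by norm_num, max (1040 ^ 32) (2 ^ 480), fun d κ hd hκ =>
      GaussianCovarianceChannel.le_capacityBits hd ((le_max_left _ _).trans hκ)
        ((le_max_right _ _).trans hκ)⟩
  obtain ⟨C, -, hC⟩ := GaussianCovarianceChannel.exists_code_of_le_logb hρ hρ1 hd hκ hk
  exact ⟨⟨C, hC⟩, (iInf_le _ C).trans hC⟩
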